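/- Let $1\le d\le 3$, let $\Omega\subset\mathbb R^d$ be a nonempty bounded connected open set, let $0<\underline q\le\overline q$, $f\in L^2(\Omega)$, $z^\delta\in H^1_0(\Omega)$ and $\rho>0$. Let $\mathcal Q_{ad}$ be the set of all $Q\in L^\infty(\Omega)^{d\times d}$ such that for a.e. $x\in\Omega$ the matrix $Q(x)$ is symmetric and $\underline q\,|\xi|^2\le Q(x)\xi\cdot\xi\le\overline q\,|\xi|^2$ for all $\xi\in\mathbb R^d$. Then for every $Q\in\mathcal Q_{ad}$ there is exactly one $u=:\mathcal U(Q)\in H^1_0(\Omega)$ with $\int_\Omega Q\nabla u\cdot\nabla v\,dx=\int_\Omega fv\,dx$ for all $v\in H^1_0(\Omega)$, and, with $$\mathcal J^\delta(Q):=\int_\Omega Q\nabla(\mathcal U(Q)-z^\delta)\cdot\nabla(\mathcal U(Q)-z^\delta)\,dx,\qquad \|Q\|^2_{L^2(\Omega)^{d\times d}}:=\int_\Omega\sum_{i,j=1}^d Q_{ij}(x)^2\,dx,$$ the functional $Q\mapsto\mathcal J^\delta(Q)+\rho\,\|Q\|^2_{L^2(\Omega)^{d\times d}}$ has exactly one minimizer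 $Q^{\rho,\delta}$ over $\mathcal Q_{ad}$ (matrix fields that agree a.e. being identified). -/

import Mathlib

open MeasureTheory
open scoped ENNReal ContDiff Matrix

namespace MatrixIdent

noncomputable section

/-- `ℝ^d` with the Euclidean norm. -/
abbrev RSpace (d : ℕ) := EuclideanSpace ℝ (Fin d)

/-- Lebesgue measure on `Ω`. -/
abbrev volOn {d : ℕ} (Ω : Set (RSpace d)) : Measure (RSpace d) := volume.restrict Ω

/-- The `i`-th classical partial derivative. -/
def partialDeriv {d : ℕ} (i : Fin d) (φ : RSpace d → ℝ) (x : RSpace d) : ℝ :=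
  fderiv ℝ φ x (EuclideanSpace.single i 1)

/-- `φ ∈ C_c^∞(Ω)`. -/
structure IsTestFunction {d : ℕ} (Ω : Set (RSpace d)) (φ : RSpace d → ℝ) : Prop where
  smooth : ContDiff ℝ ∞ φ
  compact : HasCompactSupport φ
  supp : tsupport φ ⊆ Ω

/-- `g` is the weak gradient of `u` on `Ω`: `∫_Ω u ∂ᵢφ = - ∫_Ω gᵢ φ` for all test functions `φ`. -/
def HasWeakGradient {d : ℕ} (Ω : Set (RSpace d)) (u : RSpace d → ℝ) (g : RSpace d → RSpace d) :
    Prop :=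
  ∀ φ : RSpace d → ℝ, IsTestFunction Ω φ → ∀ i : Fin d,
    ∫ x in Ω, u x * partialDeriv i φ x = - ∫ x in Ω, g x i * φ x

/-- `L²(Ω) × L²(Ω; ℝ^d)` with the Hilbert norm `‖(u, g)‖² = ‖u‖² + ‖g‖²`. -/
abbrev L2Pair {d : ℕ} (Ω : Set (RSpace d)) :=
  WithLp 2 (Lp ℝ 2 (volOn Ω) × Lp (RSpace d) 2 (volOn Ω))

theorem IsTestFunction.memLp {d : ℕ} {Ω : Set (RSpace d)} {φ : RSpace d → ℝ}
    (h : IsTestFunction Ω φ) (p : ℝ≥0∞) : MemLp φ p (volOn Ω) :=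
  (h.smooth.continuous.memLp_of_hasCompactSupport h.compact).restrict Ω

theorem IsTestFunction.memLp_partialDeriv {d : ℕ} {Ω : Set (RSpace d)} {φ : RSpace d → ℝ}
    (h : IsTestFunction Ω φ) (i : Fin d) (p : ℝ≥0∞) :
    MemLp (partialDeriv i φ) p (volOn Ω) := by
  have h1 : Continuous (partialDeriv i φ) :=
    (h.smooth.continuous_fderiv (by simp)).clm_apply continuous_const
  exact (h1.memLp_of_hasCompactSupport (h.compact.fderiv_apply ℝ _)).restrict Ω

theorem IsTestFunction.add {d : ℕ} {Ω : Set (RSpace d)} {φ ψ : RSpace d → ℝ}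
    (h : IsTestFunction Ω φ) (h' : IsTestFunction Ω ψ) : IsTestFunction Ω (φ + ψ) :=
  ⟨h.smooth.add h'.smooth, h.compact.add h'.compact,
    (tsupport_add φ ψ).trans (Set.union_subset h.supp h'.supp)⟩

theorem IsTestFunction.zero {d : ℕ} {Ω : Set (RSpace d)} :
    IsTestFunction Ω (0 : RSpace d → ℝ) :=
  ⟨contDiff_const, HasCompactSupport.zero, by simp [tsupport]⟩

theorem IsTestFunction.smul {d : ℕ} {Ω : Set (RSpace d)} {φ : RSpace d → ℝ} (c : ℝ)
    (h : IsTestFunction Ω φ) : IsTestFunction Ω (c • φ) :=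
  ⟨contDiff_const.smul h.smooth, h.compact.smul_left (f := fun _ => c),
    (tsupport_smul_subset_right (fun _ => c) φ).trans h.supp⟩

theorem memLp_coord {d : ℕ} {Ω : Set (RSpace d)} (g : Lp (RSpace d) 2 (volOn Ω)) (i : Fin d) :
    MemLp (fun x => g x i) 2 (volOn Ω) :=
  (Lp.memLp g).eval_piLp i

theorem HasWeakGradient.congr {d : ℕ} {Ω : Set (RSpace d)} {u u' : RSpace d → ℝ}
    {g g' : RSpace d → RSpace d} (h : HasWeakGradient Ω u g) (hu : u' =ᵐ[volOn Ω] u)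
    (hg : g' =ᵐ[volOn Ω] g) : HasWeakGradient Ω u' g' := by
  intro φ hφ i
  have e1 : ∫ x in Ω, u' x * partialDeriv i φ x = ∫ x in Ω, u x * partialDeriv i φ x :=
    integral_congr_ae (by filter_upwards [hu] with x hx; rw [hx])
  have e2 : ∫ x in Ω, g' x i * φ x = ∫ x in Ω, g x i * φ x :=
    integral_congr_ae (by filter_upwards [hg] with x hx; rw [hx])
  rw [e1, e2, h φ hφ i]

/-- The Sobolev space `H¹(Ω)`, realised as the space of pairs `(u, ∇u)` with `u ∈ L²(Ω)` and
weak gradient `∇u ∈ L²(Ω)^d`; the norm is `‖u‖² = ‖u‖²_{L²} + ‖∇u‖²_{L²}`. -/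
def H1 {d : ℕ} (Ω : Set (RSpace d)) : Submodule ℝ (L2Pair Ω) where
  carrier := {p | HasWeakGradient Ω p.fst p.snd}
  zero_mem' := by
    have h0 : HasWeakGradient Ω 0 0 := by intro φ _ i; simp
    exact h0.congr (Lp.coeFn_zero ℝ 2 (volOn Ω)) (Lp.coeFn_zero (RSpace d) 2 (volOn Ω))
  add_mem' := by
    intro p q hp hq
    have h0 : HasWeakGradient Ω (p.fst + q.fst : RSpace d → ℝ)
        (p.snd + q.snd : RSpace d → RSpace d) := by
      intro φ hφ i
      have a1 := (Lp.memLp p.fst).integrable_mul (hφ.memLp_partialDeriv i 2)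
      have a2 := (Lp.memLp q.fst).integrable_mul (hφ.memLp_partialDeriv i 2)
      have b1 := (memLp_coord p.snd i).integrable_mul (hφ.memLp 2)
      have b2 := (memLp_coord q.snd i).integrable_mul (hφ.memLp 2)
      have e1 := integral_add a1 a2
      have e2 := integral_add b1 b2
      simp only [Pi.mul_apply] at e1 e2
      simp only [Pi.add_apply, PiLp.add_apply, add_mul]
      rw [e1, e2, hp φ hφ i, hq φ hφ i]
      ring
    exact h0.congr (Lp.coeFn_add p.fst q.fst) (Lp.coeFn_add p.snd q.snd)
  smul_mem' := by
    intro c p hp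
    have h0 : HasWeakGradient Ω (c • p.fst : RSpace d → ℝ)
        (c • p.snd : RSpace d → RSpace d) := by
      intro φ hφ i
      simp only [Pi.smul_apply, PiLp.smul_apply, smul_eq_mul, mul_assoc]
      rw [integral_const_mul, integral_const_mul, hp φ hφ i]
      ring
    exact h0.congr (Lp.coeFn_smul c p.fst) (Lp.coeFn_smul c p.snd)

/-- `C_c^∞(Ω)` as a subspace of `H¹(Ω)`. -/
def testSubspace {d : ℕ} (Ω : Set (RSpace d)) : Submodule ℝ (H1 Ω) where
  carrier := {p | ∃ φ, IsTestFunction Ω φ ∧ (p : L2Pair Ω).fst =ᵐ[volOn Ω] φ}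
  zero_mem' := ⟨0, IsTestFunction.zero, Lp.coeFn_zero ℝ 2 (volOn Ω)⟩
  add_mem' := by
    rintro p q ⟨φ, hφ, hp⟩ ⟨ψ, hψ, hq⟩
    exact ⟨φ + ψ, hφ.add hψ, (Lp.coeFn_add _ _).trans (hp.add hq)⟩
  smul_mem' := by
    rintro c p ⟨φ, hφ, hp⟩
    exact ⟨c • φ, hφ.smul c, (Lp.coeFn_smul c _).trans (hp.const_smul c)⟩

/-- `H¹₀(Ω)`: the closure of `C_c^∞(Ω)` in `H¹(Ω)`. -/
def H10 {d : ℕ} (Ω : Set (RSpace d)) : Submodule ℝ (H1 Ω) := (testSubspace Ω).topologicalClosure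

/-- The function underlying an element of `H¹₀(Ω)`. -/
def val {d : ℕ} {Ω : Set (RSpace d)} (u : H10 Ω) : Lp ℝ 2 (volOn Ω) :=
  ((u : H1 Ω) : L2Pair Ω).fst

/-- The weak gradient of an element of `H¹₀(Ω)`. -/
def grad {d : ℕ} {Ω : Set (RSpace d)} (u : H10 Ω) : Lp (RSpace d) 2 (volOn Ω) :=
  ((u : H1 Ω) : L2Pair Ω).snd

/-- `M ⪯ N`: `Mξ · ξ ≤ Nξ · ξ` for all `ξ ∈ ℝ^d`. -/
def MatLE {d : ℕ} (M N : Matrix (Fin d) (Fin d) ℝ) : Prop :=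
  ∀ ξ : Fin d → ℝ, (M *ᵥ ξ) ⬝ᵥ ξ ≤ (N *ᵥ ξ) ⬝ᵥ ξ

/-- The set of symmetric matrices `M` with `a I ⪯ M ⪯ b I`. -/
def K (d : ℕ) (a b : ℝ) : Set (Matrix (Fin d) (Fin d) ℝ) :=
  {M | M.IsSymm ∧ MatLE (a • (1 : Matrix (Fin d) (Fin d) ℝ)) M ∧
    MatLE M (b • (1 : Matrix (Fin d) (Fin d) ℝ))}

/-- `L^∞(Ω)^{d×d}`. -/
abbrev LinftyMat {d : ℕ} (Ω : Set (RSpace d)) := Matrix (Fin d) (Fin d) (Lp ℝ ∞ (volOn Ω))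

/-- The matrix `Q(x)`. -/
def evalMat {d : ℕ} {Ω : Set (RSpace d)} (Q : LinftyMat Ω) (x : RSpace d) :
    Matrix (Fin d) (Fin d) ℝ :=
  Matrix.of fun i j => Q i j x

/-- The admissible set: `Q ∈ L^∞(Ω)^{d×d}` with `Q(x) ∈ K` for a.e. `x ∈ Ω`. -/
def Qad {d : ℕ} (Ω : Set (RSpace d)) (a b : ℝ) : Set (LinftyMat Ω) :=
  {Q | ∀ᵐ x ∂(volOn Ω), evalMat Q x ∈ K d a b}

/-- The energy form `∫_Ω Q∇u · ∇v`. -/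
def energyForm {d : ℕ} {Ω : Set (RSpace d)} (Q : LinftyMat Ω) (u v : H10 Ω) : ℝ :=
  ∫ x in Ω, (evalMat Q x *ᵥ (grad u x).ofLp) ⬝ᵥ (grad v x).ofLp

/-- `u ∈ H¹₀(Ω)` is a weak solution of `-div(Q∇u) = f` in `Ω`, `u = 0` on `∂Ω`. -/
def IsWeakSolution {d : ℕ} {Ω : Set (RSpace d)} (f : Lp ℝ 2 (volOn Ω)) (Q : LinftyMat Ω)
    (u : H10 Ω) : Prop :=
  ∀ v : H10 Ω, energyForm Q u v = ∫ x in Ω, f x * val v x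

open Classical in
/-- The coefficient-to-solution operator: `U f Q` is the weak solution for the coefficient `Q`
(and `0` where there is none). -/
def U {d : ℕ} {Ω : Set (RSpace d)} (f : Lp ℝ 2 (volOn Ω)) (Q : LinftyMat Ω) : H10 Ω :=
  if h : ∃ u : H10 Ω, IsWeakSolution f Q u then h.choose else 0

/-- The energy functional `J(Q) = ∫_Ω Q∇(U(Q) - z) · ∇(U(Q) - z)`. -/
def J {d : ℕ} {Ω : Set (RSpace d)} (f : Lp ℝ 2 (volOn Ω)) (z : H10 Ω) (Q : LinftyMat Ω) : ℝ :=
  energyForm Q (U f Q - z) (U f Q - z)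

/-- `‖Q‖²` in `L²(Ω)^{d×d}`. -/
def l2NormSq {d : ℕ} {Ω : Set (RSpace d)} (Q : LinftyMat Ω) : ℝ :=
  ∫ x in Ω, ∑ i, ∑ j, (evalMat Q x i j) ^ 2

/-- The Tikhonov functional `J(Q) + ρ‖Q‖²_{L²}`. -/
def tikhonov {d : ℕ} {Ω : Set (RSpace d)} (f : Lp ℝ 2 (volOn Ω)) (z : H10 Ω) (ρ : ℝ)
    (Q : LinftyMat Ω) : ℝ :=
  J f z Q + ρ * l2NormSq Q

end

end MatrixIdent

namespace MatrixIdent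

/-! Write `E_Q` for the energy form and `u = U f Q`. Poincaré's inequality makes `E_Q` coercive on
H¹₀(Ω), so Lax–Milgram gives the unique weak solution. Completing the square in the weak formulation
gives, for every `v` in H¹₀(Ω), J(Q) = 2∫fv - E_Q(v,v) - 2∫fz + E_Q(z,z) + E_Q(u-v,u-v). The last
term is nonnegative and vanishes at `v = u`, so J is a pointwise maximum of functionals affine in Q,
hence convex. The penalty makes the Tikhonov functional strongly convex in L²
(`tikhonov_midpoint_le`).

Strong convexity gives uniqueness and makes every minimizing sequence Cauchy in L². A subsequence
converges a.e., and its limit is admissible because the constraint set `K` is closed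
(`exists_subseq_tendsto_ae`). For lower semicontinuity it is enough to fix `v` as the solution for
the limit coefficient and pass to the limit in that single minorant by dominated convergence.
Neither weak compactness nor continuity of Q ↦ U(Q) is needed. -/

variable {d : ℕ} {Ω : Set (RSpace d)}

/-! ### Integral inequalities in L² and pointwise bounds on matrices -/

theorem integrable_norm_mul_norm {α E F : Type*} [MeasurableSpace α] {μ : Measure α}
    [NormedAddCommGroup E] [NormedAddCommGroup F] (u : Lp E 2 μ) (v : Lp F 2 μ) :
    Integrable (fun x => ‖u x‖ * ‖v x‖) μ :=
  (Lp.memLp u).norm.integrable_mul (Lp.memLp v).norm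

/-- Cauchy–Schwarz in the real space L², applied to the scalar functions ‖u‖ and ‖v‖; this lets `u`
and `v` take values in different spaces. -/
theorem integral_norm_mul_norm_le {α E F : Type*} [MeasurableSpace α] {μ : Measure α}
    [NormedAddCommGroup E] [NormedAddCommGroup F] (u : Lp E 2 μ) (v : Lp F 2 μ) :
    ∫ x, ‖u x‖ * ‖v x‖ ∂μ ≤ ‖u‖ * ‖v‖ := by
  have h := real_inner_le_norm ((Lp.memLp u).norm.toLp _) ((Lp.memLp v).norm.toLp _)
  rw [L2.inner_def, Lp.norm_toLp, Lp.norm_toLp, eLpNorm_norm, eLpNorm_norm,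
    ← Lp.norm_def, ← Lp.norm_def] at h
  refine le_trans (le_of_eq (integral_congr_ae ?_)) h
  filter_upwards [(Lp.memLp u).norm.coeFn_toLp, (Lp.memLp v).norm.coeFn_toLp] with x hx hy
  rw [hx, hy]
  simp [mul_comm]

theorem norm_sq_eq_integral {α E : Type*} [MeasurableSpace α] {μ : Measure α}
    [NormedAddCommGroup E] [InnerProductSpace ℝ E] (u : Lp E 2 μ) :
    ‖u‖ ^ 2 = ∫ x, ‖u x‖ ^ 2 ∂μ := by
  rw [← real_inner_self_eq_norm_sq, L2.inner_def]
  simp only [real_inner_self_eq_norm_sq]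

theorem abs_coord_le_norm (ξ : RSpace d) (i : Fin d) : |ξ i| ≤ ‖ξ‖ := by
  simpa using PiLp.norm_apply_le ξ i

theorem dotProduct_self_eq_norm_sq (ξ : RSpace d) : ξ.ofLp ⬝ᵥ ξ.ofLp = ‖ξ‖ ^ 2 := by
  rw [EuclideanSpace.norm_sq_eq]
  simp [dotProduct, sq]

theorem quadForm_bounds {a b : ℝ} {M : Matrix (Fin d) (Fin d) ℝ} (hM : M ∈ K d a b)
    (ξ : Fin d → ℝ) : a * (ξ ⬝ᵥ ξ) ≤ (M *ᵥ ξ) ⬝ᵥ ξ ∧ (M *ᵥ ξ) ⬝ᵥ ξ ≤ b * (ξ ⬝ᵥ ξ) := by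
  have h1 := hM.2.1 ξ
  have h2 := hM.2.2 ξ
  simp only [Matrix.smul_mulVec, Matrix.one_mulVec, smul_dotProduct, smul_eq_mul] at h1 h2
  exact ⟨h1, h2⟩

/-- Polarization: the forms at e_i + e_j and e_i - e_j both lie between 2a and 2b when i ≠ j, and
their difference is 4 M_ij. For i = j the first vector is 2e_i. The bound depends only on `b`, so it
serves as a uniform L∞ bound on admissible fields. -/
theorem abs_entry_le {a b : ℝ} (ha : 0 ≤ a) {M : Matrix (Fin d) (Fin d) ℝ} (hM : M ∈ K d a b)
    (i j : Fin d) : |M i j| ≤ b := by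
  have hpos : ∀ ξ : Fin d → ℝ, 0 ≤ ξ ⬝ᵥ ξ := fun ξ =>
    Finset.sum_nonneg fun i _ => mul_self_nonneg (ξ i)
  have hs : M j i = M i j := hM.1.apply i j
  have h1 := quadForm_bounds hM (Pi.single i 1 + Pi.single j 1)
  have h2 := quadForm_bounds hM (Pi.single i 1 - Pi.single j 1)
  have p1 := mul_nonneg ha (hpos (Pi.single i 1 + Pi.single j 1))
  have p2 := mul_nonneg ha (hpos (Pi.single i 1 - Pi.single j 1))
  by_cases hij : i = j
  · subst hij
    simp [Matrix.mulVec_add, dotProduct_add] at h1 p1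
    rw [abs_le]
    constructor <;> linarith [h1.1, h1.2]
  · simp [Matrix.mulVec_add, Matrix.mulVec_sub, dotProduct_add, dotProduct_sub, hij, Ne.symm hij, hs] at h1 h2 p1 p2
    rw [abs_le]
    constructor <;> linarith [h1.1, h1.2, h2.1, h2.2]

theorem dotProduct_mulVec_eq_sum (M : Matrix (Fin d) (Fin d) ℝ) (ξ η : Fin d → ℝ) :
    (M *ᵥ ξ) ⬝ᵥ η = ∑ i, ∑ j, M i j * (ξ j * η i) := by
  simp only [dotProduct, Matrix.mulVec, Finset.sum_mul, mul_assoc]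

theorem isClosed_K (d : ℕ) (a b : ℝ) : IsClosed (K d a b) := by
  have e : K d a b = {M | Mᵀ = M} ∩
      ((⋂ ξ : Fin d → ℝ, {M | ((a • (1 : Matrix (Fin d) (Fin d) ℝ)) *ᵥ ξ) ⬝ᵥ ξ ≤ (M *ᵥ ξ) ⬝ᵥ ξ}) ∩
      ⋂ ξ : Fin d → ℝ, {M | (M *ᵥ ξ) ⬝ᵥ ξ ≤ ((b • (1 : Matrix (Fin d) (Fin d) ℝ)) *ᵥ ξ) ⬝ᵥ ξ}) := by
    ext M
    simp [K, MatLE, Matrix.IsSymm]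
  rw [e]
  refine (isClosed_eq (by fun_prop) (by fun_prop)).inter
    ((isClosed_iInter fun ξ => isClosed_le (by fun_prop) ?_).inter
      (isClosed_iInter fun ξ => isClosed_le ?_ (by fun_prop)))
  all_goals
    simp only [dotProduct_mulVec_eq_sum]
    fun_prop

/-! ### The energy form: bilinearity, symmetry, bounds -/

theorem entry_ae_bound (q : Lp ℝ ∞ (volOn Ω)) : ∀ᵐ x ∂(volOn Ω), ‖q x‖ ≤ ‖q‖ := by
  have h := ae_le_eLpNormEssSup (f := q) (μ := volOn Ω)
  filter_upwards [h] with x hx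
  rw [Lp.norm_def, eLpNorm_exponent_top, ← toReal_enorm]
  refine ENNReal.toReal_mono ?_ hx
  rw [← eLpNorm_exponent_top]
  exact Lp.eLpNorm_ne_top q

theorem integrable_entry_mul (q : Lp ℝ ∞ (volOn Ω)) (u v : H10 Ω) (i j : Fin d) :
    Integrable (fun x => q x * (grad u x j * grad v x i)) (volOn Ω) :=
  ((memLp_coord (grad u) j).integrable_mul (memLp_coord (grad v) i)).bdd_mul
    (Lp.aestronglyMeasurable q) (entry_ae_bound q)

theorem integrable_energy (Q : LinftyMat Ω) (u v : H10 Ω) :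
    Integrable (fun x => (evalMat Q x *ᵥ (grad u x).ofLp) ⬝ᵥ (grad v x).ofLp) (volOn Ω) := by
  simp only [dotProduct_mulVec_eq_sum]
  exact integrable_finsetSum _ fun i _ => integrable_finsetSum _ fun j _ =>
    integrable_entry_mul (Q i j) u v i j

theorem grad_add_ae (u v : H10 Ω) : ∀ᵐ x ∂(volOn Ω), grad (u + v) x = grad u x + grad v x :=
  Lp.coeFn_add (grad u) (grad v)

theorem grad_smul_ae (c : ℝ) (u : H10 Ω) : ∀ᵐ x ∂(volOn Ω), grad (c • u) x = c • grad u x :=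
  Lp.coeFn_smul c (grad u)

theorem energyForm_add_left (Q : LinftyMat Ω) (u v w : H10 Ω) :
    energyForm Q (u + v) w = energyForm Q u w + energyForm Q v w := by
  rw [energyForm, energyForm, energyForm,
    ← integral_add (integrable_energy Q u w) (integrable_energy Q v w)]
  refine integral_congr_ae ?_
  filter_upwards [grad_add_ae u v] with x hx
  rw [hx, WithLp.ofLp_add, Matrix.mulVec_add, add_dotProduct]

theorem energyForm_add_right (Q : LinftyMat Ω) (u v w : H10 Ω) :
    energyForm Q u (v + w) = energyForm Q u v + energyForm Q u w := by
  rw [energyForm, energyForm, energyForm,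
    ← integral_add (integrable_energy Q u v) (integrable_energy Q u w)]
  refine integral_congr_ae ?_
  filter_upwards [grad_add_ae v w] with x hx
  rw [hx, WithLp.ofLp_add, dotProduct_add]

theorem energyForm_smul_left (Q : LinftyMat Ω) (c : ℝ) (u v : H10 Ω) :
    energyForm Q (c • u) v = c * energyForm Q u v := by
  rw [energyForm, energyForm, ← integral_const_mul]
  refine integral_congr_ae ?_
  filter_upwards [grad_smul_ae c u] with x hx
  rw [hx, WithLp.ofLp_smul, Matrix.mulVec_smul, smul_dotProduct, smul_eq_mul]

theorem energyForm_smul_right (Q : LinftyMat Ω) (c : ℝ) (u v : H10 Ω) :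
    energyForm Q u (c • v) = c * energyForm Q u v := by
  rw [energyForm, energyForm, ← integral_const_mul]
  refine integral_congr_ae ?_
  filter_upwards [grad_smul_ae c v] with x hx
  rw [hx, WithLp.ofLp_smul, dotProduct_smul, smul_eq_mul]

theorem energyForm_comm {a b : ℝ} {Q : LinftyMat Ω} (hQ : Q ∈ Qad Ω a b) (u v : H10 Ω) :
    energyForm Q u v = energyForm Q v u := by
  refine integral_congr_ae ?_
  filter_upwards [hQ] with x hx
  conv_lhs => rw [← hx.1.eq]
  rw [Matrix.mulVec_transpose, ← Matrix.dotProduct_mulVec, dotProduct_comm]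

/-- The energy form as a bilinear map. -/
noncomputable def energyBilin (Q : LinftyMat Ω) : H10 Ω →ₗ[ℝ] H10 Ω →ₗ[ℝ] ℝ :=
  LinearMap.mk₂ ℝ (energyForm Q) (energyForm_add_left Q)
    (energyForm_smul_left Q) (energyForm_add_right Q) (energyForm_smul_right Q)

theorem energyForm_sub_sub {a b : ℝ} {Q : LinftyMat Ω} (hQ : Q ∈ Qad Ω a b) (u v : H10 Ω) :
    energyForm Q (u - v) (u - v) =
      energyForm Q u u - 2 * energyForm Q u v + energyForm Q v v := by
  have h : energyBilin Q (u - v) (u - v) = energyBilin Q u u - energyBilin Q u v -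
      (energyBilin Q v u - energyBilin Q v v) := by
    simp only [map_sub, LinearMap.sub_apply]; ring
  simp only [energyBilin, LinearMap.mk₂_apply] at h
  rw [h, energyForm_comm hQ v u]
  ring

/-- Ellipticity controls only the gradient; Poincaré's inequality later turns this into coercivity
in the full H¹ norm. -/
theorem energyForm_self_ge {a b : ℝ} {Q : LinftyMat Ω} (hQ : Q ∈ Qad Ω a b) (u : H10 Ω) :
    a * ‖grad u‖ ^ 2 ≤ energyForm Q u u := by
  rw [norm_sq_eq_integral, ← integral_const_mul]
  refine integral_mono_ae ?_ (integrable_energy Q u u) ?_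
  · exact ((Lp.memLp (grad u)).integrable_norm_pow (by simp)).const_mul a
  · filter_upwards [hQ] with x hx
    have := (quadForm_bounds hx (grad u x).ofLp).1
    rwa [dotProduct_self_eq_norm_sq] at this

theorem energyForm_self_nonneg {a b : ℝ} (ha : 0 ≤ a) {Q : LinftyMat Ω} (hQ : Q ∈ Qad Ω a b)
    (u : H10 Ω) : 0 ≤ energyForm Q u u :=
  (mul_nonneg ha (sq_nonneg _)).trans (energyForm_self_ge hQ u)

/-- The constant is crude, but it needs no admissibility and is used only to show that the form is
bounded. -/
theorem abs_energyForm_le (Q : LinftyMat Ω) (u v : H10 Ω) :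
    |energyForm Q u v| ≤ (∑ i, ∑ j, ‖Q i j‖) * (‖grad u‖ * ‖grad v‖) := by
  have hb : ∀ᵐ x ∂(volOn Ω), ∀ i j, ‖Q i j x‖ ≤ ‖Q i j‖ :=
    ae_all_iff.2 fun i => ae_all_iff.2 fun j => entry_ae_bound (Q i j)
  have hC : 0 ≤ ∑ i, ∑ j, ‖Q i j‖ :=
    Finset.sum_nonneg fun i _ => Finset.sum_nonneg fun j _ => norm_nonneg _
  calc |energyForm Q u v|
      ≤ ∫ x in Ω, (∑ i, ∑ j, ‖Q i j‖) * (‖grad u x‖ * ‖grad v x‖) := by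
        rw [energyForm, ← Real.norm_eq_abs]
        refine norm_integral_le_of_norm_le
          ((integrable_norm_mul_norm (grad u) (grad v)).const_mul _) ?_
        filter_upwards [hb] with x hx
        rw [dotProduct_mulVec_eq_sum, Finset.sum_mul]
        refine (norm_sum_le _ _).trans (Finset.sum_le_sum fun i _ => ?_)
        rw [Finset.sum_mul]
        refine (norm_sum_le _ _).trans (Finset.sum_le_sum fun j _ => ?_)
        rw [norm_mul, norm_mul]
        exact mul_le_mul (hx i j) (mul_le_mul (abs_coord_le_norm _ _) (abs_coord_le_norm _ _)
          (norm_nonneg _) (norm_nonneg _)) (by positivity) (norm_nonneg _)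
    _ ≤ _ := by
        rw [integral_const_mul]
        exact mul_le_mul_of_nonneg_left (integral_norm_mul_norm_le _ _) hC

/-! ### Completeness of H¹₀(Ω) -/

theorem continuous_integral_mul {φ : RSpace d → ℝ} (hφ : MemLp φ 2 (volOn Ω)) :
    Continuous fun u : Lp ℝ 2 (volOn Ω) => ∫ x in Ω, u x * φ x := by
  have e : (fun u : Lp ℝ 2 (volOn Ω) => ∫ x in Ω, u x * φ x) =
      fun u => inner ℝ (hφ.toLp φ) u := by
    ext u
    rw [L2.inner_def]
    refine integral_congr_ae ?_
    filter_upwards [hφ.coeFn_toLp] with x hx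
    rw [hx]
    simp
  rw [e]
  exact continuous_const.inner continuous_id

theorem continuous_integral_coord_mul {φ : RSpace d → ℝ} (hφ : MemLp φ 2 (volOn Ω)) (i : Fin d) :
    Continuous fun g : Lp (RSpace d) 2 (volOn Ω) => ∫ x in Ω, g x i * φ x := by
  -- The functional is the L² inner product with the vector field φ e_i.
  have hm : MemLp (fun x => EuclideanSpace.single i (φ x)) 2 (volOn Ω) := by
    refine MemLp.of_eval_piLp fun j => ?_
    by_cases h : j = i
    · subst h; simpa using hφ
    · simp [h]
  have e : (fun g : Lp (RSpace d) 2 (volOn Ω) => ∫ x in Ω, g x i * φ x) =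
      fun g => inner ℝ (hm.toLp _) g := by
    ext g
    rw [L2.inner_def]
    refine integral_congr_ae ?_
    filter_upwards [hm.coeFn_toLp] with x hx
    rw [hx]
    simp [EuclideanSpace.inner_single_left, mul_comm]
  rw [e]
  exact continuous_const.inner continuous_id

/-- Each instance of the weak gradient identity equates two L²-continuous functionals of the pair,
hence is a closed condition. -/
theorem isClosed_H1 (Ω : Set (RSpace d)) : IsClosed (H1 Ω : Set (L2Pair Ω)) := by
  have e : (H1 Ω : Set (L2Pair Ω)) = ⋂ φ : {φ // IsTestFunction Ω φ}, ⋂ i : Fin d,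
      {p | ∫ x in Ω, p.fst x * partialDeriv i φ x = - ∫ x in Ω, p.snd x i * φ.1 x} := by
    ext p
    simp [H1, HasWeakGradient]
  rw [e]
  refine isClosed_iInter fun φ => isClosed_iInter fun i => isClosed_eq ?_ ?_
  · exact (continuous_integral_mul (φ.2.memLp_partialDeriv i 2)).comp
      (WithLp.continuous_fst 2 _ _)
  · exact ((continuous_integral_coord_mul (φ.2.memLp 2) i).comp
      (WithLp.continuous_snd 2 _ _)).neg

instance completeSpace_H10 (Ω : Set (RSpace d)) : CompleteSpace (H10 Ω) := by
  have : CompleteSpace (H1 Ω) := (isClosed_H1 Ω).completeSpace_coe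
  exact (Submodule.isClosed_topologicalClosure _).completeSpace_coe

theorem norm_sq_eq_val_add_grad (u : H10 Ω) : ‖u‖ ^ 2 = ‖val u‖ ^ 2 + ‖grad u‖ ^ 2 :=
  WithLp.prod_norm_sq_eq_of_L2 ((u : H1 Ω) : L2Pair Ω)

theorem norm_val_le (u : H10 Ω) : ‖val u‖ ≤ ‖u‖ :=
  le_of_sq_le_sq (by rw [norm_sq_eq_val_add_grad]; nlinarith [sq_nonneg ‖grad u‖]) (norm_nonneg _)

theorem norm_grad_le (u : H10 Ω) : ‖grad u‖ ≤ ‖u‖ :=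
  le_of_sq_le_sq (by rw [norm_sq_eq_val_add_grad]; nlinarith [sq_nonneg ‖val u‖]) (norm_nonneg _)

/-! ### Poincaré's inequality -/

theorem IsTestFunction.coord_mul {φ : RSpace d → ℝ} (h : IsTestFunction Ω φ) (i : Fin d) :
    IsTestFunction Ω (fun x => x i * φ x) :=
  ⟨by have := h.smooth; fun_prop, h.compact.mul_left, (tsupport_mul_subset_right).trans h.supp⟩

theorem partialDeriv_coord_mul {φ : RSpace d → ℝ} (h : IsTestFunction Ω φ) (i : Fin d)
    (x : RSpace d) :
    partialDeriv i (fun x => x i * φ x) x = φ x + x i * partialDeriv i φ x := by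
  have h1 : HasFDerivAt (fun x : RSpace d => x i) (EuclideanSpace.proj i : RSpace d →L[ℝ] ℝ) x :=
    (EuclideanSpace.proj i : RSpace d →L[ℝ] ℝ).hasFDerivAt
  have h2 := (h.smooth.differentiable (by simp) x).hasFDerivAt
  have h3 : HasFDerivAt (fun x : RSpace d => x i * φ x) _ x := h1.mul h2
  rw [partialDeriv, h3.fderiv]
  simp [partialDeriv, add_comm]

/-- Let A = ∫ φ ∂ᵢ(xᵢφ) and B = ∫ xᵢ φ ∂ᵢφ. The product rule gives A = ∫ φ² + B, and integration by
parts gives A = -B, so ∫ φ² = 2A. -/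
theorem IsTestFunction.integral_sq {φ : RSpace d → ℝ} (h : IsTestFunction Ω φ) (i : Fin d) :
    ∫ x in Ω, φ x ^ 2 = 2 * ∫ x in Ω, φ x * partialDeriv i (fun x => x i * φ x) x := by
  have hψ := h.coord_mul i
  have hz : ∀ x ∉ Ω, φ x = 0 := fun x hx => image_eq_zero_of_notMem_tsupport fun h' => hx (h.supp h')
  have hcφ := h.smooth.continuous
  have hcdφ : Continuous (partialDeriv i φ) :=
    (h.smooth.continuous_fderiv (by simp)).clm_apply continuous_const
  have hcdψ : Continuous (partialDeriv i fun x => x i * φ x) :=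
    (hψ.smooth.continuous_fderiv (by simp)).clm_apply continuous_const
  have i1 : Integrable (fun x => partialDeriv i φ x * (x i * φ x)) :=
    (hcdφ.mul hψ.smooth.continuous).integrable_of_hasCompactSupport hψ.compact.mul_left
  have i2 : Integrable (fun x => φ x * partialDeriv i (fun x => x i * φ x) x) :=
    (hcφ.mul hcdψ).integrable_of_hasCompactSupport h.compact.mul_right
  have i3 : Integrable (fun x => φ x * (x i * φ x)) :=
    (hcφ.mul hψ.smooth.continuous).integrable_of_hasCompactSupport h.compact.mul_right
  have i4 : Integrable (fun x => φ x ^ 2) := by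
    simp only [sq]
    exact (hcφ.mul hcφ).integrable_of_hasCompactSupport h.compact.mul_right
  have key := integral_mul_fderiv_eq_neg_fderiv_mul_of_integrable (μ := volume) (f := φ)
    (g := fun x => x i * φ x) (v := EuclideanSpace.single i (1 : ℝ)) i1 i2 i3
    (fun x _ => h.smooth.differentiable (by simp) x)
    (fun x _ => hψ.smooth.differentiable (by simp) x)
  rw [setIntegral_eq_integral_of_forall_compl_eq_zero (fun x hx => by simp [hz x hx]),
    setIntegral_eq_integral_of_forall_compl_eq_zero (fun x hx => by simp [hz x hx])]
  have e : ∫ x, φ x * partialDeriv i (fun x => x i * φ x) x =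
      (∫ x, φ x ^ 2) + ∫ x, partialDeriv i φ x * (x i * φ x) := by
    rw [← integral_add i4 i1]
    refine integral_congr_ae (Filter.Eventually.of_forall fun x => ?_)
    simp only [partialDeriv_coord_mul h]
    ring
  have key' : ∫ x, φ x * partialDeriv i (fun x => x i * φ x) x =
      -∫ x, partialDeriv i φ x * (x i * φ x) := key
  linarith

/-- **Poincaré's inequality** for test functions. -/
theorem norm_fst_le_of_mem_testSubspace {R : ℝ} (hR : 0 ≤ R) (hΩ : MeasurableSet Ω)
    (hΩR : ∀ x ∈ Ω, ‖x‖ ≤ R) (i : Fin d) {p : H1 Ω} (hp : p ∈ testSubspace Ω) :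
    ‖(p : L2Pair Ω).fst‖ ≤ 2 * R * ‖(p : L2Pair Ω).snd‖ := by
  obtain ⟨φ, hφ, hpφ⟩ := hp
  set u := (p : L2Pair Ω).fst with hu
  set g := (p : L2Pair Ω).snd with hg
  -- Testing the weak gradient against xᵢφ moves the derivative onto `g` directly, so `g` need not
  -- be identified with the classical gradient of φ.
  have hw : ∫ x in Ω, u x * partialDeriv i (fun x => x i * φ x) x =
      -∫ x in Ω, g x i * (x i * φ x) := p.2 _ (hφ.coord_mul i) i
  have e1 : ‖u‖ ^ 2 = ∫ x in Ω, φ x ^ 2 := by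
    rw [norm_sq_eq_integral]
    refine integral_congr_ae ?_
    filter_upwards [hpφ] with x hx
    rw [hx, Real.norm_eq_abs, sq_abs]
  have e2 : ∫ x in Ω, u x * partialDeriv i (fun x => x i * φ x) x =
      ∫ x in Ω, φ x * partialDeriv i (fun x => x i * φ x) x := by
    refine integral_congr_ae ?_
    filter_upwards [hpφ] with x hx
    rw [hx]
  have hb : |∫ x in Ω, g x i * (x i * φ x)| ≤ R * (‖g‖ * ‖u‖) := by
    refine le_trans ?_ (mul_le_mul_of_nonneg_left (integral_norm_mul_norm_le g u) hR)
    rw [← integral_const_mul]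
    rw [← Real.norm_eq_abs]
    refine norm_integral_le_of_norm_le ((integrable_norm_mul_norm g u).const_mul R) ?_
    filter_upwards [hpφ, ae_restrict_mem hΩ] with x hx hxΩ
    rw [norm_mul, norm_mul, hx]
    have h1 : ‖g x i‖ ≤ ‖g x‖ := abs_coord_le_norm _ _
    have h2 : ‖x i‖ ≤ R := (abs_coord_le_norm _ _).trans (hΩR x hxΩ)
    calc ‖g x i‖ * (‖x i‖ * ‖φ x‖) ≤ ‖g x‖ * (R * ‖φ x‖) := by gcongr
      _ = R * (‖g x‖ * ‖φ x‖) := by ring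
  have hs : ‖u‖ ^ 2 ≤ 2 * R * ‖g‖ * ‖u‖ := by
    rw [e1, hφ.integral_sq i, ← e2, hw]
    nlinarith [neg_le_abs (∫ x in Ω, g x i * (x i * φ x))]
  rcases (norm_nonneg u).eq_or_lt with h0 | h0
  · rw [← h0]; positivity
  · nlinarith

/-- **Poincaré's inequality** on `H¹₀(Ω)`. -/
theorem poincare {R : ℝ} (hR : 0 ≤ R) (hΩ : MeasurableSet Ω)
    (hΩR : ∀ x ∈ Ω, ‖x‖ ≤ R) (i : Fin d) (u : H10 Ω) : ‖val u‖ ≤ 2 * R * ‖grad u‖ := by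
  -- The inequality is a closed condition in H¹(Ω), so it passes from test functions to their
  -- closure.
  have hc : IsClosed {p : H1 Ω | ‖(p : L2Pair Ω).fst‖ ≤ 2 * R * ‖(p : L2Pair Ω).snd‖} :=
    isClosed_le (((WithLp.continuous_fst 2 _ _).comp continuous_subtype_val).norm)
      (continuous_const.mul ((WithLp.continuous_snd 2 _ _).comp continuous_subtype_val).norm)
  exact closure_minimal (fun p hp => norm_fst_le_of_mem_testSubspace hR hΩ hΩR i hp) hc u.2

/-! ### Existence and uniqueness of weak solutions -/

/-- **Lax–Milgram** for a bounded coercive bilinear form and a bounded functional. -/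
theorem existsUnique_forall_bilin_eq {V : Type*} [NormedAddCommGroup V] [InnerProductSpace ℝ V]
    [CompleteSpace V] (E : V →ₗ[ℝ] V →ₗ[ℝ] ℝ) {C c C' : ℝ}
    (hE : ∀ u v, |E u v| ≤ C * ‖u‖ * ‖v‖) (hc : 0 < c) (hEc : ∀ u, c * ‖u‖ * ‖u‖ ≤ E u u)
    (l : V →ₗ[ℝ] ℝ) (hl : ∀ v, |l v| ≤ C' * ‖v‖) : ∃! u, ∀ v, E u v = l v := by
  have hB : IsCoercive (E.mkContinuous₂ C hE) := ⟨c, hc, hEc⟩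
  let T := hB.continuousLinearEquivOfBilin
  let r : V := (InnerProductSpace.toDual ℝ V).symm (l.mkContinuous C' hl)
  have hT : ∀ u v, inner ℝ (T u) v = E u v := hB.continuousLinearEquivOfBilin_apply
  have hr : ∀ v, inner ℝ r v = l v := fun v => InnerProductSpace.toDual_symm_apply
  have hiff : ∀ u, (∀ v, E u v = l v) ↔ T u = r := fun u =>
    ⟨fun hu => ext_inner_right ℝ fun v => by rw [hT, hu, hr], fun hu v => by rw [← hT, hu, hr]⟩
  refine ⟨T.symm r, (hiff _).2 (T.apply_symm_apply r), fun u hu => ?_⟩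
  rw [← (hiff u).1 hu, T.symm_apply_apply]

/-- The linear functional `v ↦ ∫_Ω f v` on `H¹₀(Ω)`. -/
noncomputable def load (f : Lp ℝ 2 (volOn Ω)) : H10 Ω →ₗ[ℝ] ℝ where
  toFun v := inner ℝ f (val v)
  map_add' v w := inner_add_right f (val v) (val w)
  map_smul' c v := real_inner_smul_right f (val v) c

theorem integral_mul_val_eq_load (f : Lp ℝ 2 (volOn Ω)) (v : H10 Ω) :
    ∫ x in Ω, f x * val v x = load f v := by
  change _ = inner ℝ f (val v)
  rw [L2.inner_def]
  simp [mul_comm]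

theorem existsUnique_isWeakSolution (hd : 1 ≤ d) (hΩo : IsOpen Ω) (hΩb : Bornology.IsBounded Ω)
    {a b : ℝ} (ha : 0 < a) (f : Lp ℝ 2 (volOn Ω)) {Q : LinftyMat Ω} (hQ : Q ∈ Qad Ω a b) :
    ∃! u : H10 Ω, IsWeakSolution f Q u := by
  obtain ⟨R, hR, hΩR⟩ := hΩb.exists_pos_norm_le
  have hC : 0 ≤ ∑ i, ∑ j, ‖Q i j‖ :=
    Finset.sum_nonneg fun i _ => Finset.sum_nonneg fun j _ => norm_nonneg _
  -- The coercivity constant comes from ‖u‖² = ‖val u‖² + ‖grad u‖² ≤ (4R² + 1)‖grad u‖², by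
  -- Poincaré with constant 2R.
  have h := existsUnique_forall_bilin_eq (energyBilin Q) (C := ∑ i, ∑ j, ‖Q i j‖)
    (c := a / (4 * R ^ 2 + 1)) (C' := ‖f‖) (fun u v => ?_) (by positivity) (fun u => ?_) (load f)
    (fun v => (abs_real_inner_le_norm f (val v)).trans
      (mul_le_mul_of_nonneg_left (norm_val_le v) (norm_nonneg f)))
  · simpa only [IsWeakSolution, integral_mul_val_eq_load, energyBilin, LinearMap.mk₂_apply] using h
  · rw [mul_assoc]
    refine (abs_energyForm_le Q u v).trans (mul_le_mul_of_nonneg_left ?_ hC)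
    exact mul_le_mul (norm_grad_le u) (norm_grad_le v) (norm_nonneg _) (norm_nonneg _)
  · have hp := poincare hR.le hΩo.measurableSet hΩR ⟨0, hd⟩ u
    have hu : ‖u‖ ^ 2 ≤ (4 * R ^ 2 + 1) * ‖grad u‖ ^ 2 := by
      rw [norm_sq_eq_val_add_grad]
      nlinarith [pow_le_pow_left₀ (norm_nonneg _) hp 2]
    refine le_trans ?_ (energyForm_self_ge hQ u)
    rw [mul_assoc, ← sq, div_mul_eq_mul_div, div_le_iff₀ (by positivity)]
    nlinarith

theorem isWeakSolution_U (hd : 1 ≤ d) (hΩo : IsOpen Ω) (hΩb : Bornology.IsBounded Ω)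
    {a b : ℝ} (ha : 0 < a) (f : Lp ℝ 2 (volOn Ω)) {Q : LinftyMat Ω} (hQ : Q ∈ Qad Ω a b) :
    IsWeakSolution f Q (U f Q) := by
  have h := (existsUnique_isWeakSolution hd hΩo hΩb ha f hQ).exists
  rw [U, dif_pos h]
  exact h.choose_spec

/-! ### Coefficient fields in L² and convexity of the admissible set -/

/-- The entries of `Q(x)` as a point of a Euclidean space. -/
noncomputable def entries (Q : LinftyMat Ω) (x : RSpace d) : EuclideanSpace ℝ (Fin d × Fin d) :=
  WithLp.toLp 2 fun p => Q p.1 p.2 x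

theorem norm_sq_entries (Q : LinftyMat Ω) (x : RSpace d) :
    ‖entries Q x‖ ^ 2 = ∑ i, ∑ j, evalMat Q x i j ^ 2 := by
  rw [EuclideanSpace.norm_sq_eq, Fintype.sum_prod_type]
  simp [entries, evalMat]

theorem memLp_entries [IsFiniteMeasure (volOn Ω)] (Q : LinftyMat Ω) :
    MemLp (entries Q) 2 (volOn Ω) :=
  MemLp.of_eval_piLp fun p => (Lp.memLp (Q p.1 p.2)).mono_exponent le_top

theorem integrable_sum_sq_entries [IsFiniteMeasure (volOn Ω)] (Q : LinftyMat Ω) :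
    Integrable (fun x => ∑ i, ∑ j, evalMat Q x i j ^ 2) (volOn Ω) := by
  simp only [← norm_sq_entries]
  exact (memLp_entries Q).integrable_norm_pow (by simp)

theorem evalMat_sub_ae (P Q : LinftyMat Ω) :
    ∀ᵐ x ∂(volOn Ω), evalMat (P - Q) x = evalMat P x - evalMat Q x := by
  have h : ∀ᵐ x ∂(volOn Ω), ∀ i j, (P i j - Q i j : Lp ℝ ∞ (volOn Ω)) x = P i j x - Q i j x :=
    ae_all_iff.2 fun i => ae_all_iff.2 fun j => Lp.coeFn_sub _ _
  filter_upwards [h] with x hx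
  ext i j
  exact hx i j

theorem evalMat_add_ae (P Q : LinftyMat Ω) :
    ∀ᵐ x ∂(volOn Ω), evalMat (P + Q) x = evalMat P x + evalMat Q x := by
  have h : ∀ᵐ x ∂(volOn Ω), ∀ i j, (P i j + Q i j : Lp ℝ ∞ (volOn Ω)) x = P i j x + Q i j x :=
    ae_all_iff.2 fun i => ae_all_iff.2 fun j => Lp.coeFn_add _ _
  filter_upwards [h] with x hx
  ext i j
  exact hx i j

theorem evalMat_smul_ae (c : ℝ) (Q : LinftyMat Ω) :
    ∀ᵐ x ∂(volOn Ω), evalMat (c • Q) x = c • evalMat Q x := by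
  have h : ∀ᵐ x ∂(volOn Ω), ∀ i j, (c • Q i j : Lp ℝ ∞ (volOn Ω)) x = c • Q i j x :=
    ae_all_iff.2 fun i => ae_all_iff.2 fun j => Lp.coeFn_smul _ _
  filter_upwards [h] with x hx
  ext i j
  exact hx i j

theorem ext_of_evalMat_ae {P Q : LinftyMat Ω} (h : ∀ᵐ x ∂(volOn Ω), evalMat P x = evalMat Q x) :
    P = Q := by
  ext1 i j
  refine Lp.ext ?_
  filter_upwards [h] with x hx
  exact congrFun (congrFun hx i) j

theorem exists_linftyMat_evalMat_ae_eq [IsFiniteMeasure (volOn Ω)]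
    {G : RSpace d → Matrix (Fin d) (Fin d) ℝ}
    (hG : ∀ i j, AEStronglyMeasurable (fun x => G x i j) (volOn Ω)) {C : ℝ}
    (hC : ∀ i j, ∀ᵐ x ∂(volOn Ω), |G x i j| ≤ C) :
    ∃ Q : LinftyMat Ω, ∀ᵐ x ∂(volOn Ω), evalMat Q x = G x := by
  have hm : ∀ i j, MemLp (fun x => G x i j) ∞ (volOn Ω) := fun i j =>
    MemLp.of_bound (hG i j) C (hC i j)
  refine ⟨Matrix.of fun i j => (hm i j).toLp _, ?_⟩
  have h : ∀ᵐ x ∂(volOn Ω), ∀ i j, ((hm i j).toLp (fun x => G x i j)) x = G x i j :=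
    ae_all_iff.2 fun i => ae_all_iff.2 fun j => (hm i j).coeFn_toLp
  filter_upwards [h] with x hx
  ext i j
  exact hx i j

theorem Qad_nonempty [IsFiniteMeasure (volOn Ω)] {a b : ℝ} (hab : a ≤ b) :
    (Qad Ω a b).Nonempty := by
  obtain ⟨Q, hQ⟩ := exists_linftyMat_evalMat_ae_eq (Ω := Ω)
    (G := fun _ => a • (1 : Matrix (Fin d) (Fin d) ℝ)) (C := |a|)
    (fun i j => aestronglyMeasurable_const) (fun i j => Filter.Eventually.of_forall fun _ => by
      by_cases h : i = j <;> simp [h])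
  refine ⟨Q, ?_⟩
  filter_upwards [hQ] with x hx
  rw [hx]
  refine ⟨by simp [Matrix.IsSymm], fun ξ => le_rfl, fun ξ => ?_⟩
  simp only [Matrix.smul_mulVec, Matrix.one_mulVec, smul_dotProduct, smul_eq_mul]
  exact mul_le_mul_of_nonneg_right hab (Finset.sum_nonneg fun i _ => mul_self_nonneg (ξ i))

theorem midpoint_mem_K {a b : ℝ} {M N : Matrix (Fin d) (Fin d) ℝ} (hM : M ∈ K d a b)
    (hN : N ∈ K d a b) : (1 / 2 : ℝ) • (M + N) ∈ K d a b := by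
  refine ⟨(hM.1.add hN.1).smul _, fun ξ => ?_, fun ξ => ?_⟩
  · have h1 := hM.2.1 ξ
    have h2 := hN.2.1 ξ
    rw [Matrix.smul_mulVec _ (M + N), Matrix.add_mulVec, smul_dotProduct, add_dotProduct,
      smul_eq_mul]
    linarith
  · have h1 := hM.2.2 ξ
    have h2 := hN.2.2 ξ
    rw [Matrix.smul_mulVec _ (M + N), Matrix.add_mulVec, smul_dotProduct, add_dotProduct,
      smul_eq_mul]
    linarith

theorem midpoint_mem_Qad {a b : ℝ} {P Q : LinftyMat Ω} (hP : P ∈ Qad Ω a b)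
    (hQ : Q ∈ Qad Ω a b) : (1 / 2 : ℝ) • (P + Q) ∈ Qad Ω a b := by
  filter_upwards [hP, hQ, evalMat_smul_ae (1 / 2) (P + Q), evalMat_add_ae P Q] with x h1 h2 h3 h4
  rw [h3, h4]
  exact midpoint_mem_K h1 h2

theorem energyForm_midpoint (P Q : LinftyMat Ω) (u v : H10 Ω) :
    energyForm ((1 / 2 : ℝ) • (P + Q)) u v = (energyForm P u v + energyForm Q u v) / 2 := by
  rw [energyForm, energyForm, energyForm,
    ← integral_add (integrable_energy P u v) (integrable_energy Q u v), ← integral_div]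
  refine integral_congr_ae ?_
  filter_upwards [evalMat_smul_ae (1 / 2) (P + Q), evalMat_add_ae P Q] with x h1 h2
  rw [h1, h2, Matrix.smul_mulVec, Matrix.add_mulVec, smul_dotProduct, add_dotProduct, smul_eq_mul]
  ring

/-- The parallelogram law; its defect term is the source of strong convexity. -/
theorem l2NormSq_midpoint [IsFiniteMeasure (volOn Ω)] (P Q : LinftyMat Ω) :
    l2NormSq ((1 / 2 : ℝ) • (P + Q)) =
      (l2NormSq P + l2NormSq Q) / 2 - l2NormSq (P - Q) / 4 := by
  have hi : Integrable (fun x => (∑ i, ∑ j, evalMat P x i j ^ 2 +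
      ∑ i, ∑ j, evalMat Q x i j ^ 2) / 2) (volOn Ω) :=
    ((integrable_sum_sq_entries P).add (integrable_sum_sq_entries Q)).div_const 2
  rw [l2NormSq, l2NormSq, l2NormSq, l2NormSq,
    ← integral_add (integrable_sum_sq_entries P) (integrable_sum_sq_entries Q), ← integral_div,
    ← integral_div, ← integral_sub hi ((integrable_sum_sq_entries (P - Q)).div_const 4)]
  refine integral_congr_ae ?_
  filter_upwards [evalMat_smul_ae (1 / 2) (P + Q), evalMat_add_ae P Q, evalMat_sub_ae P Q]
    with x h1 h2 h3
  rw [h1, h2, h3]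
  simp only [Matrix.smul_apply, Matrix.add_apply, Matrix.sub_apply, smul_eq_mul,
    Finset.sum_div, ← Finset.sum_add_distrib, ← Finset.sum_sub_distrib]
  refine Finset.sum_congr rfl fun i _ => Finset.sum_congr rfl fun j _ => ?_
  ring

theorem l2NormSq_nonneg (Q : LinftyMat Ω) : 0 ≤ l2NormSq Q :=
  integral_nonneg fun _ => Finset.sum_nonneg fun _ _ => Finset.sum_nonneg fun _ _ => sq_nonneg _

/-- Places coefficient fields isometrically in a complete L² space, where Cauchy sequences have
limits. -/
theorem norm_toLp_sub_sq [IsFiniteMeasure (volOn Ω)] (P Q : LinftyMat Ω) :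
    ‖(memLp_entries P).toLp _ - (memLp_entries Q).toLp _‖ ^ 2 = l2NormSq (P - Q) := by
  rw [norm_sq_eq_integral]
  refine integral_congr_ae ?_
  filter_upwards [Lp.coeFn_sub ((memLp_entries P).toLp _) ((memLp_entries Q).toLp _),
    (memLp_entries P).coeFn_toLp, (memLp_entries Q).coeFn_toLp, evalMat_sub_ae P Q]
    with x h1 h2 h3 h4
  rw [← norm_sq_entries, h1, Pi.sub_apply, h2, h3]
  congr 2
  ext p
  exact (congrFun (congrFun h4 p.1) p.2).symm

theorem eq_of_l2NormSq_sub_eq_zero [IsFiniteMeasure (volOn Ω)] {P Q : LinftyMat Ω}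
    (h : l2NormSq (P - Q) = 0) : P = Q := by
  rw [← norm_toLp_sub_sq, sq_eq_zero_iff, norm_eq_zero, sub_eq_zero,
    MemLp.toLp_eq_toLp_iff] at h
  refine ext_of_evalMat_ae ?_
  filter_upwards [h] with x hx
  ext i j
  exact congrArg (fun e : EuclideanSpace ℝ (Fin d × Fin d) => e (i, j)) hx

/-! ### Passage to the limit along a.e. convergent coefficients -/

/-- Dominated convergence: `u` stays fixed, and b|∇u|² dominates because the upper bound `b` is
common to all the coefficients. -/
theorem tendsto_energyForm_self {a b : ℝ} (ha : 0 ≤ a) {P : ℕ → LinftyMat Ω} {Q : LinftyMat Ω}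
    (hP : ∀ n, P n ∈ Qad Ω a b)
    (h : ∀ᵐ x ∂(volOn Ω),
      Filter.Tendsto (fun n => evalMat (P n) x) Filter.atTop (nhds (evalMat Q x))) (u : H10 Ω) :
    Filter.Tendsto (fun n => energyForm (P n) u u) Filter.atTop (nhds (energyForm Q u u)) := by
  refine tendsto_integral_of_dominated_convergence (fun x => b * ‖grad u x‖ ^ 2)
    (fun n => (integrable_energy (P n) u u).aestronglyMeasurable)
    (((Lp.memLp (grad u)).integrable_norm_pow (by simp)).const_mul b) (fun n => ?_) ?_
  · filter_upwards [hP n] with x hx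
    have hb := quadForm_bounds hx (grad u x).ofLp
    rw [dotProduct_self_eq_norm_sq] at hb
    rw [Real.norm_eq_abs, abs_of_nonneg ((mul_nonneg ha (sq_nonneg _)).trans hb.1)]
    exact hb.2
  · filter_upwards [h] with x hx
    have hc : Continuous fun M : Matrix (Fin d) (Fin d) ℝ =>
        (M *ᵥ (grad u x).ofLp) ⬝ᵥ (grad u x).ofLp := by
      simp only [dotProduct_mulVec_eq_sum]; fun_prop
    exact (hc.tendsto _).comp hx

theorem tendsto_l2NormSq [IsFiniteMeasure (volOn Ω)] {a b : ℝ} (ha : 0 ≤ a)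
    {P : ℕ → LinftyMat Ω} {Q : LinftyMat Ω} (hP : ∀ n, P n ∈ Qad Ω a b)
    (h : ∀ᵐ x ∂(volOn Ω),
      Filter.Tendsto (fun n => evalMat (P n) x) Filter.atTop (nhds (evalMat Q x))) :
    Filter.Tendsto (fun n => l2NormSq (P n)) Filter.atTop (nhds (l2NormSq Q)) := by
  refine tendsto_integral_of_dominated_convergence (fun x => ∑ i : Fin d, ∑ j : Fin d, b ^ 2)
    (fun n => (integrable_sum_sq_entries (P n)).aestronglyMeasurable)
    (integrable_const _) (fun n => ?_) ?_
  · filter_upwards [hP n] with x hx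
    rw [Real.norm_eq_abs, abs_of_nonneg
      (Finset.sum_nonneg fun _ _ => Finset.sum_nonneg fun _ _ => sq_nonneg _)]
    refine Finset.sum_le_sum fun i _ => Finset.sum_le_sum fun j _ => ?_
    exact sq_le_sq' (neg_le_of_abs_le (abs_entry_le ha hx i j)) (le_of_abs_le (abs_entry_le ha hx i j))
  · filter_upwards [h] with x hx
    have hc : Continuous fun M : Matrix (Fin d) (Fin d) ℝ => ∑ i, ∑ j, M i j ^ 2 := by fun_prop
    exact (hc.tendsto _).comp hx

/-- A sequence in `Qad` that is Cauchy in `L²` has a subsequence converging a.e. to an element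
of `Qad`. -/
theorem exists_subseq_tendsto_ae [IsFiniteMeasure (volOn Ω)] {a b : ℝ} (ha : 0 ≤ a)
    {P : ℕ → LinftyMat Ω} (hP : ∀ n, P n ∈ Qad Ω a b)
    (hc : ∀ ε > 0, ∃ N, ∀ m ≥ N, ∀ n ≥ N, l2NormSq (P m - P n) < ε) :
    ∃ Q ∈ Qad Ω a b, ∃ ns : ℕ → ℕ, StrictMono ns ∧ ∀ᵐ x ∂(volOn Ω),
      Filter.Tendsto (fun n => evalMat (P (ns n)) x) Filter.atTop (nhds (evalMat Q x)) := by
  have hcs : CauchySeq fun n => (memLp_entries (P n)).toLp _ := by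
    refine Metric.cauchySeq_iff.2 fun ε hε => ?_
    -- `l2NormSq` is a squared distance, hence ε².
    obtain ⟨N, hN⟩ := hc (ε ^ 2) (by positivity)
    refine ⟨N, fun m hm n hn => ?_⟩
    rw [dist_eq_norm]
    refine lt_of_pow_lt_pow_left₀ 2 hε.le ?_
    rw [norm_toLp_sub_sq]
    exact hN m hm n hn
  obtain ⟨G, hG⟩ := cauchySeq_tendsto_of_complete hcs
  obtain ⟨ns, hns, hlim⟩ := (tendstoInMeasure_of_tendsto_Lp hG).exists_seq_tendsto_ae
  have hco : ∀ᵐ x ∂(volOn Ω), ∀ n, ((memLp_entries (P n)).toLp _) x = entries (P n) x :=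
    ae_all_iff.2 fun n => (memLp_entries (P n)).coeFn_toLp
  let G' : RSpace d → Matrix (Fin d) (Fin d) ℝ := fun x => Matrix.of fun i j => G x (i, j)
  have hlim' : ∀ᵐ x ∂(volOn Ω),
      Filter.Tendsto (fun n => evalMat (P (ns n)) x) Filter.atTop (nhds (G' x)) := by
    filter_upwards [hlim, hco] with x h1 h2
    simp only [h2] at h1
    have hcont : Continuous fun e : EuclideanSpace ℝ (Fin d × Fin d) =>
        (Matrix.of fun i j => e (i, j) : Matrix (Fin d) (Fin d) ℝ) :=
      continuous_matrix fun i j => by simp only [Matrix.of_apply]; fun_prop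
    exact (hcont.tendsto _).comp h1
  -- Closedness of `K` gives admissibility of the limit and also bounds its entries by `b`, so the
  -- L² limit has a representative in L∞.
  have hK : ∀ᵐ x ∂(volOn Ω), G' x ∈ K d a b := by
    filter_upwards [hlim', ae_all_iff.2 fun n => hP (ns n)] with x h1 h2
    exact (isClosed_K d a b).mem_of_tendsto h1 (Filter.Eventually.of_forall h2)
  obtain ⟨Q, hQ⟩ := exists_linftyMat_evalMat_ae_eq (Ω := Ω) (G := G') (C := b)
    (fun i j => ((Lp.memLp G).eval_piLp (i, j)).aestronglyMeasurable)
    (fun i j => by filter_upwards [hK] with x hx using abs_entry_le ha hx i j)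
  refine ⟨Q, ?_, ns, hns, ?_⟩
  · filter_upwards [hK, hQ] with x h1 h2
    rwa [h2]
  · filter_upwards [hlim', hQ] with x h1 h2
    rwa [h2]

/-! ### Affine minorants, strong convexity and the minimizer -/

/-- For each `v`, a lower bound of the Tikhonov functional that is affine in `Q` up to the
penalty; equality holds at `v = U f Q`. -/
noncomputable def tikhonovMinorant (f : Lp ℝ 2 (volOn Ω)) (z : H10 Ω) (ρ : ℝ) (v : H10 Ω)
    (Q : LinftyMat Ω) : ℝ :=
  2 * load f v - energyForm Q v v - 2 * load f z + energyForm Q z z + ρ * l2NormSq Q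

/-- Completing the square: expand both energies and use E_Q(U(Q), ·) = `load f`. The gap to the
minorant is the energy of U(Q) - v. -/
theorem tikhonov_eq_of_isWeakSolution {a b : ℝ} {f : Lp ℝ 2 (volOn Ω)} {Q : LinftyMat Ω}
    (hQ : Q ∈ Qad Ω a b) (hU : IsWeakSolution f Q (U f Q)) (z : H10 Ω) (ρ : ℝ) (v : H10 Ω) :
    tikhonov f z ρ Q = tikhonovMinorant f z ρ v Q + energyForm Q (U f Q - v) (U f Q - v) := by
  have h : ∀ v, energyForm Q (U f Q) v = load f v := fun v => by
    rw [hU v, integral_mul_val_eq_load]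
  rw [tikhonov, J, tikhonovMinorant, energyForm_sub_sub hQ, energyForm_sub_sub hQ, h z, h v]
  ring

theorem tikhonovMinorant_le {a b : ℝ} (ha : 0 ≤ a) {f : Lp ℝ 2 (volOn Ω)} {Q : LinftyMat Ω}
    (hQ : Q ∈ Qad Ω a b) (hU : IsWeakSolution f Q (U f Q)) (z : H10 Ω) (ρ : ℝ) (v : H10 Ω) :
    tikhonovMinorant f z ρ v Q ≤ tikhonov f z ρ Q := by
  rw [tikhonov_eq_of_isWeakSolution hQ hU z ρ v]
  linarith [energyForm_self_nonneg ha hQ (U f Q - v)]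

theorem tikhonovMinorant_U {a b : ℝ} {f : Lp ℝ 2 (volOn Ω)} {Q : LinftyMat Ω}
    (hQ : Q ∈ Qad Ω a b) (hU : IsWeakSolution f Q (U f Q)) (z : H10 Ω) (ρ : ℝ) :
    tikhonov f z ρ Q = tikhonovMinorant f z ρ (U f Q) Q := by
  have h0 : energyForm Q (U f Q - U f Q) (U f Q - U f Q) = 0 := by
    rw [energyForm_sub_sub hQ]; ring
  rw [tikhonov_eq_of_isWeakSolution hQ hU z ρ (U f Q), h0, add_zero]

/-- Strong midpoint convexity of the Tikhonov functional. -/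
theorem tikhonov_midpoint_le [IsFiniteMeasure (volOn Ω)] {a b : ℝ} (ha : 0 ≤ a)
    {f : Lp ℝ 2 (volOn Ω)} (hU : ∀ Q ∈ Qad Ω a b, IsWeakSolution f Q (U f Q)) (z : H10 Ω) (ρ : ℝ)
    {P Q : LinftyMat Ω} (hP : P ∈ Qad Ω a b) (hQ : Q ∈ Qad Ω a b) :
    tikhonov f z ρ ((1 / 2 : ℝ) • (P + Q)) ≤
      (tikhonov f z ρ P + tikhonov f z ρ Q) / 2 - ρ / 4 * l2NormSq (P - Q) := by
  have hM := midpoint_mem_Qad hP hQ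
  rw [tikhonovMinorant_U hM (hU _ hM)]
  -- The solution at the midpoint is the common `v` for both endpoints: the minorant is exact at the
  -- midpoint, a lower bound at `P` and `Q`, and affine in between apart from the penalty.
  set w := U f ((1 / 2 : ℝ) • (P + Q))
  have h1 := tikhonovMinorant_le ha hP (hU P hP) z ρ w
  have h2 := tikhonovMinorant_le ha hQ (hU Q hQ) z ρ w
  rw [tikhonovMinorant] at h1 h2 ⊢
  rw [energyForm_midpoint, energyForm_midpoint, l2NormSq_midpoint]
  linarith

theorem tikhonov_nonneg {a b : ℝ} (ha : 0 ≤ a) {ρ : ℝ} (hρ : 0 ≤ ρ) (f : Lp ℝ 2 (volOn Ω))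
    (z : H10 Ω) {Q : LinftyMat Ω} (hQ : Q ∈ Qad Ω a b) : 0 ≤ tikhonov f z ρ Q :=
  add_nonneg (energyForm_self_nonneg ha hQ _) (mul_nonneg hρ (l2NormSq_nonneg Q))

theorem exists_tikhonov_minimizer [IsFiniteMeasure (volOn Ω)] {a b : ℝ} (ha : 0 ≤ a) (hab : a ≤ b)
    {f : Lp ℝ 2 (volOn Ω)} (hU : ∀ Q ∈ Qad Ω a b, IsWeakSolution f Q (U f Q)) (z : H10 Ω) {ρ : ℝ}
    (hρ : 0 < ρ) :
    ∃ Q ∈ Qad Ω a b, ∀ P ∈ Qad Ω a b, tikhonov f z ρ Q ≤ tikhonov f z ρ P := by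
  set S := tikhonov f z ρ '' Qad Ω a b
  have hbdd : BddBelow S := ⟨0, by rintro _ ⟨Q, hQ, rfl⟩; exact tikhonov_nonneg ha hρ.le f z hQ⟩
  obtain ⟨t, -, htlim, htS⟩ := exists_seq_tendsto_sInf ((Qad_nonempty hab).image _) hbdd
  choose P hP hPt using htS
  have hle : ∀ Q ∈ Qad Ω a b, sInf S ≤ tikhonov f z ρ Q := fun Q hQ => csInf_le hbdd ⟨Q, hQ, rfl⟩
  -- Two values below inf + ρε/4 with a midpoint value at least inf force (ρ/4)‖P m - P n‖² < ρε/4.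
  have hcauchy : ∀ ε > 0, ∃ N, ∀ m ≥ N, ∀ n ≥ N, l2NormSq (P m - P n) < ε := by
    intro ε hε
    obtain ⟨N, hN⟩ := Filter.eventually_atTop.1
      (htlim.eventually (gt_mem_nhds (show sInf S < sInf S + ρ * ε / 4 by linarith [mul_pos hρ hε])))
    refine ⟨N, fun m hm n hn => ?_⟩
    have h1 := tikhonov_midpoint_le ha hU z ρ (hP m) (hP n)
    have h2 := hle _ (midpoint_mem_Qad (hP m) (hP n))
    have h3 := hN m hm
    have h4 := hN n hn
    rw [hPt, hPt] at h1
    refine lt_of_mul_lt_mul_left ?_ hρ.le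
    linarith
  obtain ⟨Q, hQ, ns, hns, hlim⟩ := exists_subseq_tendsto_ae ha hP hcauchy
  refine ⟨Q, hQ, fun R hR => le_trans ?_ (hle R hR)⟩
  -- Lower semicontinuity: the minorant for the solution at the limit `Q` is exact at `Q`, converges
  -- along the subsequence, and stays below the Tikhonov values, which tend to the infimum.
  rw [tikhonovMinorant_U hQ (hU Q hQ)]
  set w := U f Q
  have hF : Filter.Tendsto (fun n => tikhonovMinorant f z ρ w (P (ns n))) Filter.atTop
      (nhds (tikhonovMinorant f z ρ w Q)) := by
    have e1 := tendsto_energyForm_self ha (fun n => hP (ns n)) hlim w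
    have e2 := tendsto_energyForm_self ha (fun n => hP (ns n)) hlim z
    have e3 := tendsto_l2NormSq ha (fun n => hP (ns n)) hlim
    exact (((e1.const_sub _).sub_const _).add e2).add (e3.const_mul ρ)
  refine le_of_tendsto_of_tendsto' hF (htlim.comp hns.tendsto_atTop) fun n => ?_
  rw [Function.comp_apply, ← hPt]
  exact tikhonovMinorant_le ha (hP _) (hU _ (hP _)) z ρ w

end MatrixIdent

theorem theorem2p5 (d : ℕ) (hd : 1 ≤ d) (hd3 : d ≤ 3)
    (Ω : Set (MatrixIdent.RSpace d)) (hΩo : IsOpen Ω) (hΩb : Bornology.IsBounded Ω)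
    (hΩc : IsConnected Ω)
    (a b : ℝ) (ha : 0 < a) (hab : a ≤ b)
    (f : Lp ℝ 2 (MatrixIdent.volOn Ω)) (z : MatrixIdent.H10 Ω) (ρ : ℝ) (hρ : 0 < ρ) :
    (∀ Q ∈ MatrixIdent.Qad Ω a b,
      ∃! u : MatrixIdent.H10 Ω, MatrixIdent.IsWeakSolution f Q u) ∧
    ∃! Q : MatrixIdent.LinftyMat Ω, Q ∈ MatrixIdent.Qad Ω a b ∧
      ∀ P ∈ MatrixIdent.Qad Ω a b,
        MatrixIdent.tikhonov f z ρ Q ≤ MatrixIdent.tikhonov f z ρ P := by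
  have : IsFiniteMeasure (MatrixIdent.volOn Ω) :=
    ⟨by rw [Measure.restrict_apply_univ]; exact hΩb.measure_lt_top⟩
  have hU : ∀ Q ∈ MatrixIdent.Qad Ω a b, MatrixIdent.IsWeakSolution f Q (MatrixIdent.U f Q) :=
    fun Q hQ => MatrixIdent.isWeakSolution_U hd hΩo hΩb ha f hQ
  refine ⟨fun Q hQ => MatrixIdent.existsUnique_isWeakSolution hd hΩo hΩb ha f hQ, ?_⟩
  obtain ⟨Q, hQ, hmin⟩ := MatrixIdent.exists_tikhonov_minimizer ha.le hab hU z hρ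
  refine ⟨Q, ⟨hQ, hmin⟩, fun P hP => MatrixIdent.eq_of_l2NormSq_sub_eq_zero ?_⟩
  -- Both minimizers attain the same value and the midpoint cannot go below it, so the convexity
  -- defect (ρ/4)‖P - Q‖² must vanish.
  have h1 := MatrixIdent.tikhonov_midpoint_le ha.le hU z ρ hP.1 hQ
  have h2 := hmin _ (MatrixIdent.midpoint_mem_Qad hP.1 hQ)
  have h3 := hP.2 Q hQ
  have h4 := MatrixIdent.l2NormSq_nonneg (P - Q)
  refine le_antisymm (le_of_mul_le_mul_left ?_ hρ) h4
  linarith
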